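/- Let $\alpha>0$, $\bar\gamma>0$ and $m>0$ be real numbers, and put $b=\frac{m}{\alpha\bar\gamma}$. Let $Q(z)=\frac{1}{\sqrt{2\pi}}\int_z^\infty e^{-t^2/2}\,dt$ be the Gauss $Q$-function and let $$f_\gamma(\gamma)=\frac{1}{\Gamma(m)}\Big(\frac{m}{\bar\gamma}\Big)^{m}\gamma^{m-1}e^{-m\gamma/\bar\gamma}\qquad(\gamma>0)$$ be the density of the instantaneous signal-to-noise ratio (SNR) in Nakagami-$m$ fading with mean SNR $\bar\gamma$. Then $$\int_0^\infty Q^2\big(\sqrt{2\alpha\gamma}\big)f_\gamma(\gamma)\,d\gamma=\frac14\,I_{\frac{m}{m+\alpha\bar\gamma}}\Big(m,\frac12\Big)-R_2(\alpha,\bar\gamma,m),$$ where $$R_2(\alpha,\bar\gamma,m)=\frac{b^m}{4\pi}\sum_{n=0}^\infty\frac{(1-m)_n\,B\big(n+m+1,\frac12\big)}{n!\,\big(n+\frac12\big)\,B\big(\frac12,m\big)}\,F_1\Big(n+m+1,\,m,\,n+\frac12;\,m+n+\frac32;\,-b,\,-(1+b)\Big);$$ the integral on the left and the series both converge absolutely.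 Here $(x)_n=x(x+1)\cdots(x+n-1)$ is the Pochhammer symbol, $B(p,q)=\Gamma(p)\Gamma(q)/\Gamma(p+q)$ is the beta function, $I_x(p,q)=\frac{1}{B(p,q)}\int_0^x t^{p-1}(1-t)^{q-1}\,dt$ is the regularized incomplete beta function, and $F_1$ is the Appell hypergeometric function, given for real $0<a<c$ and real $x,y<1$ by $$F_1(a,\rho,\lambda;c;x,y)=\frac{1}{B(a,c-a)}\int_0^1 t^{a-1}(1-t)^{c-a-1}(1-xt)^{-\rho}(1-yt)^{-\lambda}\,dt.$$ -/

import Mathlib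

open MeasureTheory Set

noncomputable section

namespace Nakagami

/-- The Gauss Q-function `Q(z) = (2π)^(-1/2) ∫_z^∞ exp(-t²/2) dt`. -/
def gaussQ (z : ℝ) : ℝ :=
  (1 / Real.sqrt (2 * Real.pi)) * ∫ t in Ioi z, Real.exp (-t ^ 2 / 2)

/-- The density of the instantaneous SNR in Nakagami-`m` fading with mean SNR `g`: the gamma
density with shape `m` and rate `m / g`, that is
`(m / g) ^ m / Γ(m) * x ^ (m - 1) * exp (-(m / g) * x)` for `x ≥ 0`. -/
def snrPDF (m g x : ℝ) : ℝ :=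
  ProbabilityTheory.gammaPDFReal m (m / g) x

/-- The incomplete beta function `B_x(a, b)`, for `a, b > 0` and `0 ≤ x ≤ 1`. -/
def incBeta (x a b : ℝ) : ℝ :=
  ∫ t in (0 : ℝ)..x, t ^ (a - 1) * (1 - t) ^ (b - 1)

/-- The regularized incomplete beta function `I_x(a, b) = B_x(a, b) / B(a, b)`. -/
def regIncBeta (x a b : ℝ) : ℝ :=
  incBeta x a b / ProbabilityTheory.beta a b

/-- The Appell hypergeometric function `F₁(a, r, l; c; x, y)` through its Euler integral, for real
parameters with `0 < a < c` and real arguments `x, y < 1`. -/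
def appellF1 (a r l c x y : ℝ) : ℝ :=
  (1 / ProbabilityTheory.beta a (c - a)) *
    ∫ t in (0 : ℝ)..1,
      t ^ (a - 1) * (1 - t) ^ (c - a - 1) * (1 - x * t) ^ (-r) * (1 - y * t) ^ (-l)

/-- The `n`-th term of the series in `R₂(α, g, m)`. -/
def R2term (α g m : ℝ) (n : ℕ) : ℝ :=
  ((ascPochhammer ℝ n).eval (1 - m) * ProbabilityTheory.beta (n + m + 1) (1 / 2)) /
      ((n.factorial : ℝ) * (n + 1 / 2) * ProbabilityTheory.beta (1 / 2) m) *
    appellF1 (n + m + 1) m (n + 1 / 2) (m + n + 3 / 2) (-(m / (α * g))) (-(1 + m / (α * g)))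

/-- The quantity `R₂(α, g, m)`. -/
def R2 (α g m : ℝ) : ℝ :=
  (m / (α * g)) ^ m / (4 * Real.pi) * ∑' n : ℕ, R2term α g m n

end Nakagami

end

open MeasureTheory Set

noncomputable section

namespace Nakagami

/-! The identity `Q² = 1/4 - (1/2)(1/2 - Q) - Q(1/2 - Q)` splits the mean into three parts. The
constant contributes `1/4`. The mean of `1/2 - Q` is a regularized incomplete beta value
(`integral_half_sub_gaussQ_mul_gammaPDFReal`), and the reflection `I_x(p, q) + I_{1-x}(q, p) = 1`
merges these two parts into the first term of the formula.

The mean of `Q(1/2 - Q)` is `R₂`. Craig's formula (`gaussQ_craig`) writes the factor `Q` as a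
mixture of exponentials `exp(-αx/t)`, each of which only raises the rate of the gamma density from
`m/g` to `m/g + α/t`. The mean of `1/2 - Q` at the new rate is an incomplete beta value at `w = t /
(1 + (1 + b)t)`. Expanding it in powers of `w` and integrating over `t` termwise gives the Euler
integrals of `F₁` (`hasSum_R2term`); since `w ≤ 1/2`, the series converges geometrically. -/

/-! ### Fubini, beta and gamma integrals. -/

lemma setIntegral_swap_of_nonneg {f : ℝ → ℝ → ℝ} {s t : Set ℝ} (hs : MeasurableSet s)
    (ht : MeasurableSet t) (hf : Measurable (Function.uncurry f))
    (h0 : ∀ x ∈ s, ∀ y ∈ t, 0 ≤ f x y) (hfi : ∀ x ∈ s, IntegrableOn (f x) t)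
    (hi : IntegrableOn (fun x => ∫ y in t, f x y) s) :
    ∫ x in s, ∫ y in t, f x y = ∫ y in t, ∫ x in s, f x y := by
  refine integral_integral_swap ((integrable_prod_iff hf.aestronglyMeasurable).2 ⟨?_, ?_⟩)
  · exact ae_restrict_of_forall_mem hs hfi
  · refine hi.congr (ae_restrict_of_forall_mem hs fun x hx => ?_)
    refine setIntegral_congr_fun ht fun y hy => ?_
    simp [Function.uncurry, abs_of_nonneg (h0 x hx y hy)]

lemma integral_Ioo_beta {p q : ℝ} (hp : 0 < p) (hq : 0 < q) :
    ∫ x in Ioo (0 : ℝ) 1, x ^ (p - 1) * (1 - x) ^ (q - 1) = ProbabilityTheory.beta p q := by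
  have h := ProbabilityTheory.lintegral_betaPDF_eq_one hp hq
  have hb := ProbabilityTheory.beta_pos hp hq
  rw [ProbabilityTheory.lintegral_betaPDF, ← ENNReal.toReal_eq_one_iff,
    ← integral_eq_lintegral_of_nonneg_ae] at h
  · simp_rw [mul_assoc, integral_const_mul] at h
    field_simp at h
    exact h
  · refine ae_restrict_of_forall_mem measurableSet_Ioo fun x hx => ?_
    have := hx.1; have := sub_pos.2 hx.2
    simp only [Pi.zero_apply]
    positivity
  · exact Measurable.aestronglyMeasurable (by fun_prop)

/-- A non-integrable function has Bochner integral `0` by convention, so a nonzero value certifies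
integrability. -/
lemma integrableOn_Ioo_beta {p q : ℝ} (hp : 0 < p) (hq : 0 < q) :
    IntegrableOn (fun x : ℝ => x ^ (p - 1) * (1 - x) ^ (q - 1)) (Ioo 0 1) :=
  Integrable.of_integral_ne_zero
    (by rw [integral_Ioo_beta hp hq]; exact (ProbabilityTheory.beta_pos hp hq).ne')

lemma integrableOn_rpow_mul_exp_neg_mul_Ioi {a r : ℝ} (ha : 0 < a) (hr : 0 < r) :
    IntegrableOn (fun t : ℝ => t ^ (a - 1) * Real.exp (-(r * t))) (Ioi 0) :=
  Integrable.of_integral_ne_zero (by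
    rw [Real.integral_rpow_mul_exp_neg_mul_Ioi ha hr]
    have := Real.Gamma_pos_of_pos ha
    positivity)

lemma incBeta_eq_setIntegral {x : ℝ} (hx : 0 ≤ x) (p q : ℝ) :
    incBeta x p q = ∫ s in Ioo (0 : ℝ) x, s ^ (p - 1) * (1 - s) ^ (q - 1) := by
  rw [incBeta, intervalIntegral.integral_of_le hx, integral_Ioc_eq_integral_Ioo]

lemma incBeta_add_symm {x p q : ℝ} (hx0 : 0 ≤ x) (hx1 : x ≤ 1) (hp : 0 < p) (hq : 0 < q) :
    incBeta (1 - x) q p + incBeta x p q = ProbabilityTheory.beta p q := by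
  have hi : IntervalIntegrable (fun s : ℝ => s ^ (p - 1) * (1 - s) ^ (q - 1)) volume 0 1 := by
    rw [intervalIntegrable_iff_integrableOn_Ioo_of_le zero_le_one]
    exact integrableOn_Ioo_beta hp hq
  have h1 : incBeta (1 - x) q p = ∫ s in x..1, s ^ (p - 1) * (1 - s) ^ (q - 1) := by
    have := intervalIntegral.integral_comp_sub_left
      (a := 0) (b := 1 - x) (fun s : ℝ => s ^ (p - 1) * (1 - s) ^ (q - 1)) 1
    simp only [sub_sub_cancel, sub_zero] at this
    rw [← this, incBeta]
    simp only [mul_comm]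
  rw [h1, incBeta, add_comm, intervalIntegral.integral_add_adjacent_intervals,
    intervalIntegral.integral_of_le zero_le_one, integral_Ioc_eq_integral_Ioo,
    integral_Ioo_beta hp hq]
  · exact hi.mono_set (by rw [uIcc_of_le hx0, uIcc_of_le zero_le_one]; exact Icc_subset_Icc_right hx1)
  · exact hi.mono_set (by rw [uIcc_of_le hx1, uIcc_of_le zero_le_one]; exact Icc_subset_Icc_left hx0)

/-- Substitution `s = r / (c + r)`, under which `1 - s = c / (c + r)`. -/
lemma setIntegral_rpow_mul_add_rpow {c a p q : ℝ} (hc : 0 < c) (ha : 0 < a) :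
    ∫ r in Ioo 0 a, r ^ (p - 1) * (c + r) ^ (-(p + q)) =
      c ^ (-q) * incBeta (a / (c + a)) p q := by
  have himg : (fun r : ℝ => r / (c + r)) '' Ioo 0 a = Ioo 0 (a / (c + a)) := by
    ext s
    constructor
    · rintro ⟨r, ⟨h0, h1⟩, rfl⟩
      refine ⟨by positivity, ?_⟩
      change r / (c + r) < _
      rw [div_lt_div_iff₀ (by positivity) (by positivity)]
      nlinarith
    · rintro ⟨h0, h1⟩
      rw [lt_div_iff₀ (by positivity)] at h1
      have h2 : 0 < 1 - s := by
        by_contra! h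
        nlinarith
      refine ⟨c * s / (1 - s), ⟨by positivity, ?_⟩, ?_⟩
      · rw [div_lt_iff₀ h2]; nlinarith
      · field_simp; ring
  have hmono : MonotoneOn (fun r : ℝ => r / (c + r)) (Ioo 0 a) := by
    intro x hx y hy hxy
    have := hx.1; have := hy.1
    change x / (c + x) ≤ y / (c + y)
    rw [div_le_div_iff₀ (by positivity) (by positivity)]
    nlinarith
  rw [incBeta_eq_setIntegral (by positivity), ← himg,
    integral_image_eq_integral_deriv_smul_of_monotoneOn measurableSet_Ioo
      (f' := fun r => c / (c + r) ^ 2) ?_ hmono, ← integral_const_mul]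
  · refine setIntegral_congr_fun measurableSet_Ioo fun r hr => ?_
    have hr0 := hr.1
    have hcr : 0 < c + r := by positivity
    have e : 1 - r / (c + r) = c / (c + r) := by field_simp; ring
    simp only [smul_eq_mul]
    rw [e, Real.div_rpow hr0.le hcr.le, Real.div_rpow hc.le hcr.le, Real.rpow_sub_one hc.ne',
      Real.rpow_sub_one hcr.ne', Real.rpow_sub_one hcr.ne', Real.rpow_neg hc.le,
      Real.rpow_neg hcr.le, Real.rpow_add hcr]
    field_simp
  · intro r hr
    have hr0 := hr.1
    have := (hasDerivAt_id r).div ((hasDerivAt_id r).const_add c) (by simp; positivity)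
    refine (this.congr_deriv ?_).hasDerivWithinAt
    simp

/-! ### Integral representations of `Q`. -/

/-- Substitution `s = t² / 2`. -/
lemma gaussQ_sqrt_two_mul {y : ℝ} (hy : 0 < y) :
    gaussQ (Real.sqrt (2 * y)) =
      1 / (2 * Real.sqrt Real.pi) * ∫ s in Ioi y, s ^ (-(1 / 2) : ℝ) * Real.exp (-s) := by
  set z := Real.sqrt (2 * y) with hz
  have hz0 : 0 < z := by positivity
  have hzy : z ^ 2 = 2 * y := Real.sq_sqrt (by positivity)
  have himg : (fun t : ℝ => t ^ 2 / 2) '' Ioi z = Ioi y := by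
    ext s
    constructor
    · rintro ⟨t, ht, rfl⟩
      have ht : z < t := ht
      change y < t ^ 2 / 2
      nlinarith
    · intro hs
      have hs : y < s := hs
      refine ⟨Real.sqrt (2 * s), Real.sqrt_lt_sqrt (by positivity) (by linarith), ?_⟩
      simp only
      rw [Real.sq_sqrt (by linarith)]; ring
  have hmono : MonotoneOn (fun t : ℝ => t ^ 2 / 2) (Ioi z) := by
    intro a ha b hb hab
    have ha : z < a := ha
    change a ^ 2 / 2 ≤ b ^ 2 / 2
    nlinarith
  rw [← himg, integral_image_eq_integral_deriv_smul_of_monotoneOn measurableSet_Ioi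
      (f' := fun t => t) ?_ hmono, gaussQ]
  · have : ∫ t in Ioi z, t • ((t ^ 2 / 2) ^ (-(1 / 2) : ℝ) * Real.exp (-(t ^ 2 / 2))) =
        ∫ t in Ioi z, Real.sqrt 2 * Real.exp (-t ^ 2 / 2) := by
      refine setIntegral_congr_fun measurableSet_Ioi fun t ht => ?_
      have ht0 : 0 < t := hz0.trans ht
      simp only [smul_eq_mul]
      rw [Real.rpow_neg (by positivity), ← Real.sqrt_eq_rpow, Real.sqrt_div (by positivity),
        Real.sqrt_sq ht0.le, neg_div]
      field_simp
    rw [this, integral_const_mul, ← mul_assoc]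
    congr 1
    rw [Real.sqrt_mul (by norm_num)]
    have := Real.sq_sqrt (show (0 : ℝ) ≤ 2 by norm_num)
    field_simp
    linarith
  · intro t _
    have := ((hasDerivAt_id t).pow 2).div_const 2
    refine (this.congr_deriv ?_).hasDerivWithinAt
    simp

lemma integrableOn_rpow_neg_half_mul_exp :
    IntegrableOn (fun s : ℝ => s ^ (-(1 / 2) : ℝ) * Real.exp (-s)) (Ioi 0) := by
  have := integrableOn_rpow_mul_exp_neg_mul_Ioi (a := 1 / 2) (r := 1) (by norm_num) one_pos
  norm_num at this ⊢
  exact this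

lemma integral_rpow_neg_half_mul_exp_neg_mul {r : ℝ} (hr : 0 < r) :
    ∫ s in Ioi (0 : ℝ), s ^ (-(1 / 2) : ℝ) * Real.exp (-(r * s)) =
      Real.sqrt Real.pi * r ^ (-(1 / 2) : ℝ) := by
  have := Real.integral_rpow_mul_exp_neg_mul_Ioi (a := 1 / 2) (r := r) (by norm_num) hr
  rw [Real.Gamma_one_half_eq, show (1 / 2 - 1 : ℝ) = -(1 / 2) by norm_num, one_div r,
    Real.inv_rpow hr.le, ← Real.rpow_neg hr.le] at this
  rw [this, mul_comm]

/-- The complement `1/2 - Q` as an error-function integral over a fixed interval. -/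
lemma half_sub_gaussQ {x a : ℝ} (hx : 0 < x) (ha : 0 < a) :
    1 / 2 - gaussQ (Real.sqrt (2 * a * x)) = 1 / (2 * Real.sqrt Real.pi) *
      (x ^ (1 / 2 : ℝ) * ∫ r in Ioo 0 a, r ^ (-(1 / 2) : ℝ) * Real.exp (-(r * x))) := by
  have hax : 0 < a * x := by positivity
  have hpi : 0 < Real.sqrt Real.pi := Real.sqrt_pos.2 Real.pi_pos
  rw [show 2 * a * x = 2 * (a * x) by ring, gaussQ_sqrt_two_mul hax]
  have h1 : ∫ s in Ioi (0 : ℝ), s ^ (-(1 / 2) : ℝ) * Real.exp (-s) = Real.sqrt Real.pi := by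
    have := integral_rpow_neg_half_mul_exp_neg_mul one_pos
    simpa using this
  have h2 := setIntegral_union (μ := volume) (f := fun s : ℝ => s ^ (-(1 / 2) : ℝ) * Real.exp (-s))
    (s := Ioc 0 (a * x)) (t := Ioi (a * x)) (Ioc_disjoint_Ioi le_rfl) measurableSet_Ioi
    (integrableOn_rpow_neg_half_mul_exp.mono_set Ioc_subset_Ioi_self)
    (integrableOn_rpow_neg_half_mul_exp.mono_set (Ioi_subset_Ioi hax.le))
  rw [Ioc_union_Ioi_eq_Ioi hax.le, h1] at h2
  -- Scaling `s = r x` makes the interval independent of `x`, so that `x` can later be integrated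
  -- first.
  have h3 : ∫ s in Ioc (0 : ℝ) (a * x), s ^ (-(1 / 2) : ℝ) * Real.exp (-s) =
      x ^ (1 / 2 : ℝ) * ∫ r in Ioo 0 a, r ^ (-(1 / 2) : ℝ) * Real.exp (-(r * x)) := by
    have := intervalIntegral.mul_integral_comp_mul_right
      (a := 0) (b := a) (f := fun s : ℝ => s ^ (-(1 / 2) : ℝ) * Real.exp (-s)) x
    rw [zero_mul, intervalIntegral.integral_of_le hax.le, intervalIntegral.integral_of_le ha.le,
      integral_Ioc_eq_integral_Ioo (x := (0 : ℝ)) (y := a)] at this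
    rw [← this, ← integral_const_mul, ← integral_const_mul]
    refine setIntegral_congr_fun measurableSet_Ioo fun r hr => ?_
    have e : x = x ^ (1 / 2 : ℝ) * x ^ (1 / 2 : ℝ) := by
      rw [← Real.rpow_add hx]; norm_num
    rw [Real.mul_rpow hr.1.le hx.le, Real.rpow_neg hx.le]
    have : x ^ (1 / 2 : ℝ) ≠ 0 := by positivity
    nth_rewrite 1 [e]
    field_simp
  rw [← h3]
  have : Real.sqrt Real.pi - ∫ s in Ioi (a * x), s ^ (-(1 / 2) : ℝ) * Real.exp (-s) =
    ∫ s in Ioc (0 : ℝ) (a * x), s ^ (-(1 / 2) : ℝ) * Real.exp (-s) := by linarith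
  rw [← this]
  field_simp

/-- Craig's formula, in the variable `t = sin² θ`. -/
lemma gaussQ_craig {y : ℝ} (hy : 0 < y) :
    gaussQ (Real.sqrt (2 * y)) = 1 / (2 * Real.pi) *
      ∫ t in Ioo (0 : ℝ) 1, Real.exp (-(y / t)) * (t ^ (-(1 / 2) : ℝ) * (1 - t) ^ (-(1 / 2) : ℝ)) := by
  -- The factor `s^(-1/2)` is itself a gamma integral in `r`. In the resulting double integral,
  -- integrating over `s` first leaves `exp(-(1 + r)y) / (1 + r)`.
  have hinner : ∀ s ∈ Ioi y,
      ∫ r in Ioi (0 : ℝ), r ^ (-(1 / 2) : ℝ) * Real.exp (-((1 + r) * s)) =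
        Real.sqrt Real.pi * (s ^ (-(1 / 2) : ℝ) * Real.exp (-s)) := by
    intro s hs
    have hs0 : 0 < s := hy.trans hs
    have e := integral_rpow_neg_half_mul_exp_neg_mul hs0
    rw [← mul_assoc, ← e, ← integral_mul_const]
    refine setIntegral_congr_fun measurableSet_Ioi fun r _ => ?_
    rw [mul_assoc, ← Real.exp_add]
    ring_nf
  have hswap := setIntegral_swap_of_nonneg
    (f := fun s r : ℝ => r ^ (-(1 / 2) : ℝ) * Real.exp (-((1 + r) * s)))
    (measurableSet_Ioi (a := y)) (measurableSet_Ioi (a := (0 : ℝ)))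
    (by unfold Function.uncurry; fun_prop)
    (fun s _ r hr => by have : 0 < r := hr; positivity)
    (fun s hs => Integrable.of_integral_ne_zero (by
      have hs0 : 0 < s := hy.trans hs
      have := Real.pi_pos
      rw [hinner s hs]
      positivity))
    (by
      rw [integrableOn_congr_fun hinner measurableSet_Ioi]
      exact (integrableOn_rpow_neg_half_mul_exp.mono_set (Ioi_subset_Ioi hy.le)).const_mul _)
  rw [setIntegral_congr_fun measurableSet_Ioi hinner, integral_const_mul] at hswap
  -- The substitution `t = 1 / (1 + r)` produces the arcsine weight.
  have himg : (fun r : ℝ => (1 + r)⁻¹) '' Ioi 0 = Ioo 0 1 := by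
    ext t
    constructor
    · rintro ⟨r, hr, rfl⟩
      have hr : 0 < r := hr
      exact ⟨by positivity, inv_lt_one_of_one_lt₀ (by linarith)⟩
    · rintro ⟨h0, h1⟩
      refine ⟨t⁻¹ - 1, ?_, by simp⟩
      have := (one_lt_inv₀ h0).2 h1
      change 0 < t⁻¹ - 1
      linarith
  have hanti : AntitoneOn (fun r : ℝ => (1 + r)⁻¹) (Ioi 0) := by
    intro a ha b _ hab
    have ha : 0 < a := ha
    exact inv_anti₀ (by positivity) (by linarith)
  have hsub : ∫ t in Ioo (0 : ℝ) 1,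
        Real.exp (-(y / t)) * (t ^ (-(1 / 2) : ℝ) * (1 - t) ^ (-(1 / 2) : ℝ)) =
      ∫ r in Ioi (0 : ℝ), ∫ s in Ioi y, r ^ (-(1 / 2) : ℝ) * Real.exp (-((1 + r) * s)) := by
    rw [← himg, integral_image_eq_integral_deriv_smul_of_antitoneOn measurableSet_Ioi
      (f' := fun r => -((1 + r) ^ 2)⁻¹) ?_ hanti]
    · refine setIntegral_congr_fun measurableSet_Ioi fun r hr => ?_
      have hr0 : 0 < r := hr
      have h1r : 0 < 1 + r := by positivity
      have e : 1 - (1 + r)⁻¹ = r / (1 + r) := by field_simp; ring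
      have e2 : (1 + r) ^ (-(1 / 2) : ℝ) * (1 + r) ^ (-(1 / 2) : ℝ) = (1 + r)⁻¹ := by
        rw [← Real.rpow_add h1r, ← Real.rpow_neg_one]; norm_num
      have e3 := integral_exp_mul_Ioi (a := -(1 + r)) (by linarith) y
      simp only [neg_mul] at e3
      have e4 : (1 + r) ^ (-(1 / 2) : ℝ) ≠ 0 := by positivity
      simp only [smul_eq_mul]
      rw [integral_const_mul, e3, e, Real.inv_rpow h1r.le, Real.div_rpow hr0.le h1r.le, div_inv_eq_mul,
        mul_comm y, ← div_eq_inv_mul, div_div, e2]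
      field_simp
    · intro r hr
      have hr0 : 0 < r := hr
      have := ((hasDerivAt_id r).const_add 1).inv (by simp; positivity)
      refine (this.congr_deriv ?_).hasDerivWithinAt
      simp [neg_div]
  rw [hsub, ← hswap, gaussQ_sqrt_two_mul hy]
  have := Real.sq_sqrt Real.pi_pos.le
  have := Real.pi_pos
  field_simp
  rw [Real.sq_sqrt Real.pi_pos.le, mul_comm]

open ProbabilityTheory

/-! ### Means under a gamma density. -/

lemma gaussQ_nonneg (z : ℝ) : 0 ≤ gaussQ z :=
  mul_nonneg (by positivity) (integral_nonneg fun _ => (Real.exp_pos _).le)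

lemma gaussQ_antitone : Antitone gaussQ := by
  intro a b hab
  have hi : Integrable fun t : ℝ => Real.exp (-t ^ 2 / 2) := by
    have := integrable_exp_neg_mul_sq (b := 1 / 2) (by norm_num)
    refine this.congr (ae_of_all _ fun t => ?_)
    simp only
    ring_nf
  refine mul_le_mul_of_nonneg_left ?_ (by positivity)
  exact setIntegral_mono_set hi.integrableOn (ae_of_all _ fun _ => (Real.exp_pos _).le)
    (Ioi_subset_Ioi hab).eventuallyLE

lemma measurable_gaussQ : Measurable gaussQ := gaussQ_antitone.measurable

lemma gaussQ_le_half {a x : ℝ} (ha : 0 < a) (hx : 0 < x) :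
    gaussQ (Real.sqrt (2 * a * x)) ≤ 1 / 2 := by
  rw [← sub_nonneg, half_sub_gaussQ hx ha]
  refine mul_nonneg (by positivity) (mul_nonneg (by positivity) ?_)
  refine setIntegral_nonneg measurableSet_Ioo fun r hr => ?_
  have := hr.1
  positivity

lemma gammaPDFReal_of_pos (m c : ℝ) {x : ℝ} (hx : 0 < x) :
    gammaPDFReal m c x = c ^ m / Real.Gamma m * (x ^ (m - 1) * Real.exp (-(c * x))) := by
  rw [gammaPDFReal, if_pos hx.le, mul_assoc]

lemma integral_Ioi_gammaPDFReal {m c : ℝ} (hm : 0 < m) (hc : 0 < c) :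
    ∫ x in Ioi 0, gammaPDFReal m c x = 1 := by
  rw [setIntegral_congr_fun measurableSet_Ioi (fun x hx => gammaPDFReal_of_pos m c hx),
    integral_const_mul, Real.integral_rpow_mul_exp_neg_mul_Ioi hm hc, one_div,
    Real.inv_rpow hc.le]
  have := Real.Gamma_pos_of_pos hm
  field_simp

lemma integrableOn_gammaPDFReal {m c : ℝ} (hm : 0 < m) (hc : 0 < c) :
    IntegrableOn (gammaPDFReal m c) (Ioi 0) :=
  integrable_of_integral_eq_one (integral_Ioi_gammaPDFReal hm hc)

lemma integrableOn_mul_gammaPDFReal {m c C : ℝ} (hm : 0 < m) (hc : 0 < c) {h : ℝ → ℝ}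
    (hh : Measurable h) (hb : ∀ x, 0 < x → |h x| ≤ C) :
    IntegrableOn (fun x => h x * gammaPDFReal m c x) (Ioi 0) :=
  (integrableOn_gammaPDFReal hm hc).bdd_mul hh.aestronglyMeasurable
    (ae_restrict_of_forall_mem measurableSet_Ioi hb)

/-- The mean of `1/2 - Q` under a gamma density. -/
lemma integral_half_sub_gaussQ_mul_gammaPDFReal {a m c : ℝ} (ha : 0 < a) (hm : 0 < m)
    (hc : 0 < c) :
    ∫ x in Ioi (0 : ℝ), (1 / 2 - gaussQ (Real.sqrt (2 * a * x))) * gammaPDFReal m c x =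
      incBeta (a / (c + a)) (1 / 2) m / (2 * beta (1 / 2) m) := by
  have hG := Real.Gamma_pos_of_pos hm
  have hG' := Real.Gamma_pos_of_pos (show 0 < m + 1 / 2 by positivity)
  -- With `x` integrated first, this is a gamma integral of shape `m + 1/2` and rate `c + r`.
  have hinner : ∀ r ∈ Ioo 0 a, ∫ x in Ioi (0 : ℝ),
      r ^ (-(1 / 2) : ℝ) * (x ^ (m + 1 / 2 - 1) * Real.exp (-((c + r) * x))) =
        Real.Gamma (m + 1 / 2) * (r ^ (1 / 2 - 1 : ℝ) * (c + r) ^ (-(1 / 2 + m))) := by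
    intro r hr
    have hr0 := hr.1
    rw [integral_const_mul, Real.integral_rpow_mul_exp_neg_mul_Ioi (by positivity) (by positivity),
      one_div (c + r), Real.inv_rpow (by positivity), ← Real.rpow_neg (by positivity),
      show (1 / 2 - 1 : ℝ) = -(1 / 2) by norm_num, add_comm m]
    ring
  have hswap := setIntegral_swap_of_nonneg
    (f := fun r x : ℝ => r ^ (-(1 / 2) : ℝ) * (x ^ (m + 1 / 2 - 1) * Real.exp (-((c + r) * x))))
    (measurableSet_Ioo (a := 0) (b := a)) (measurableSet_Ioi (a := (0 : ℝ)))
    (by unfold Function.uncurry; fun_prop)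
    (fun r hr x hx => by have : 0 < x := hx; have := hr.1; positivity)
    (fun r hr => (integrableOn_rpow_mul_exp_neg_mul_Ioi (by positivity)
      (by have := hr.1; positivity)).const_mul _)
    (by
      rw [integrableOn_congr_fun hinner measurableSet_Ioo]
      refine Integrable.const_mul ?_ _
      have h1 : IntegrableOn (fun r : ℝ => r ^ (1 / 2 - 1 : ℝ)) (Ioo 0 a) := by
        rw [intervalIntegral.integrableOn_Ioo_rpow_iff ha]; norm_num
      refine h1.mul_bdd (c := c ^ (-(1 / 2 + m)))
        (Measurable.aestronglyMeasurable (by fun_prop)) ?_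
      refine ae_restrict_of_forall_mem measurableSet_Ioo fun r hr => ?_
      have hr0 := hr.1
      rw [Real.norm_of_nonneg (by positivity)]
      exact Real.rpow_le_rpow_of_nonpos hc (by linarith) (by linarith))
  rw [setIntegral_congr_fun measurableSet_Ioo hinner, integral_const_mul,
    setIntegral_rpow_mul_add_rpow hc ha] at hswap
  have hx : ∀ x ∈ Ioi (0 : ℝ),
      (1 / 2 - gaussQ (Real.sqrt (2 * a * x))) * gammaPDFReal m c x =
      c ^ m / (Real.Gamma m * (2 * Real.sqrt Real.pi)) * ∫ r in Ioo 0 a,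
        r ^ (-(1 / 2) : ℝ) * (x ^ (m + 1 / 2 - 1) * Real.exp (-((c + r) * x))) := by
    intro x hx
    have hx0 : 0 < x := hx
    have e : ∫ r in Ioo 0 a,
        r ^ (-(1 / 2) : ℝ) * (x ^ (m + 1 / 2 - 1) * Real.exp (-((c + r) * x))) =
        x ^ (m - 1) * Real.exp (-(c * x)) * (x ^ (1 / 2 : ℝ) *
          ∫ r in Ioo 0 a, r ^ (-(1 / 2) : ℝ) * Real.exp (-(r * x))) := by
      rw [← mul_assoc, ← integral_const_mul]
      refine setIntegral_congr_fun measurableSet_Ioo fun r _ => ?_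
      rw [show m + 1 / 2 - 1 = m - 1 + 1 / 2 by ring, Real.rpow_add hx0,
        show -((c + r) * x) = -(c * x) + -(r * x) by ring, Real.exp_add]
      ring
    rw [e, half_sub_gaussQ hx0 ha, gammaPDFReal_of_pos m c hx0]
    ring
  rw [setIntegral_congr_fun measurableSet_Ioi hx, integral_const_mul, ← hswap, beta,
    Real.Gamma_one_half_eq, Real.rpow_neg hc.le, add_comm m]
  rw [add_comm m] at hG'
  have := Real.pi_pos
  field_simp

lemma integrableOn_arcsine :
    IntegrableOn (fun t : ℝ => t ^ (-(1 / 2) : ℝ) * (1 - t) ^ (-(1 / 2) : ℝ)) (Ioo 0 1) := by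
  have := integrableOn_Ioo_beta (p := 1 / 2) (q := 1 / 2) (by norm_num) (by norm_num)
  norm_num at this ⊢
  exact this

/-- The mean of `Q (1/2 - Q)` under a gamma density. -/
lemma integral_gaussQ_mul_half_sub_mul_gammaPDFReal {a m c : ℝ} (ha : 0 < a) (hm : 0 < m)
    (hc : 0 < c) :
    ∫ x in Ioi (0 : ℝ), gaussQ (Real.sqrt (2 * a * x)) *
        (1 / 2 - gaussQ (Real.sqrt (2 * a * x))) * gammaPDFReal m c x =
      1 / (2 * Real.pi) * ∫ t in Ioo (0 : ℝ) 1,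
        t ^ (-(1 / 2) : ℝ) * (1 - t) ^ (-(1 / 2) : ℝ) * (c ^ m * (c + a / t) ^ (-m)) *
          (incBeta (a / (c + a / t + a)) (1 / 2) m / (2 * beta (1 / 2) m)) := by
  have hQ : Measurable fun x : ℝ => gaussQ (Real.sqrt (2 * a * x)) :=
    measurable_gaussQ.comp (by fun_prop)
  have hP : Measurable (gammaPDFReal m c) := measurable_gammaPDFReal m c
  have hrate : ∀ t : ℝ, 0 < t → 0 < c + a / t := fun t ht => by positivity
  -- The factor `exp(-a x / t)` turns the density of rate `c` into that of rate `c + a/t`, up to the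
  -- ratio `c^m (c + a/t)^(-m)` of normalizing constants.
  have hinner : ∀ t ∈ Ioo (0 : ℝ) 1, ∫ x in Ioi (0 : ℝ),
      (1 / 2 - gaussQ (Real.sqrt (2 * a * x))) * gammaPDFReal m c x *
        (Real.exp (-(a * x / t)) * (t ^ (-(1 / 2) : ℝ) * (1 - t) ^ (-(1 / 2) : ℝ))) =
      t ^ (-(1 / 2) : ℝ) * (1 - t) ^ (-(1 / 2) : ℝ) * (c ^ m * (c + a / t) ^ (-m)) *
          (incBeta (a / (c + a / t + a)) (1 / 2) m / (2 * beta (1 / 2) m)) := by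
    intro t ht
    have hc' := hrate t ht.1
    rw [← integral_half_sub_gaussQ_mul_gammaPDFReal ha hm hc', ← integral_const_mul]
    refine setIntegral_congr_fun measurableSet_Ioi fun x hx => ?_
    rw [gammaPDFReal_of_pos m c hx, gammaPDFReal_of_pos m _ hx, Real.rpow_neg hc'.le,
      show -((c + a / t) * x) = -(c * x) + -(a * x / t) by ring, Real.exp_add]
    have := Real.Gamma_pos_of_pos hm
    field_simp
  have hcraig : ∀ x ∈ Ioi (0 : ℝ), ∫ t in Ioo (0 : ℝ) 1,
      (1 / 2 - gaussQ (Real.sqrt (2 * a * x))) * gammaPDFReal m c x *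
        (Real.exp (-(a * x / t)) * (t ^ (-(1 / 2) : ℝ) * (1 - t) ^ (-(1 / 2) : ℝ))) =
      2 * Real.pi * (gaussQ (Real.sqrt (2 * a * x)) *
        (1 / 2 - gaussQ (Real.sqrt (2 * a * x))) * gammaPDFReal m c x) := by
    intro x hx
    have h := gaussQ_craig (y := a * x) (mul_pos ha hx)
    rw [← mul_assoc] at h
    rw [integral_const_mul]
    -- Only the standalone factor `Q` is expanded; the copies inside `1/2 - Q` stay.
    nth_rewrite 2 [h]
    have := Real.pi_pos
    field_simp
  have hmeas : Measurable (Function.uncurry fun x t : ℝ =>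
      (1 / 2 - gaussQ (Real.sqrt (2 * a * x))) * gammaPDFReal m c x *
        (Real.exp (-(a * x / t)) * (t ^ (-(1 / 2) : ℝ) * (1 - t) ^ (-(1 / 2) : ℝ)))) := by
    have h1 : Measurable fun p : ℝ × ℝ => gaussQ (Real.sqrt (2 * a * p.1)) :=
      hQ.comp measurable_fst
    have h2 : Measurable fun p : ℝ × ℝ => gammaPDFReal m c p.1 := hP.comp measurable_fst
    exact ((measurable_const.sub h1).mul h2).mul (by fun_prop)
  have hswap := setIntegral_swap_of_nonneg
    (f := fun x t : ℝ => (1 / 2 - gaussQ (Real.sqrt (2 * a * x))) * gammaPDFReal m c x *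
        (Real.exp (-(a * x / t)) * (t ^ (-(1 / 2) : ℝ) * (1 - t) ^ (-(1 / 2) : ℝ))))
    (measurableSet_Ioi (a := (0 : ℝ))) (measurableSet_Ioo (a := (0 : ℝ)) (b := 1))
    hmeas
    (fun x hx t ht => by
      have h1 := sub_nonneg.2 (gaussQ_le_half ha hx)
      have h2 := gammaPDFReal_nonneg hm hc x
      have := ht.1; have := sub_pos.2 ht.2
      positivity)
    (fun x hx => by
      refine Integrable.const_mul ?_ _
      refine integrableOn_arcsine.bdd_mul (c := 1) (by fun_prop) ?_
      refine ae_restrict_of_forall_mem measurableSet_Ioo fun t ht => ?_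
      have hx0 : 0 < x := hx
      have := ht.1
      rw [Real.norm_of_nonneg (Real.exp_pos _).le, Real.exp_le_one_iff, neg_nonpos]
      positivity)
    (by
      rw [integrableOn_congr_fun hcraig measurableSet_Ioi]
      refine Integrable.const_mul ?_ _
      refine integrableOn_mul_gammaPDFReal (C := 1) hm hc (hQ.mul (measurable_const.sub hQ)) ?_
      intro x hx
      have h1 := gaussQ_le_half ha hx
      have h2 := gaussQ_nonneg (Real.sqrt (2 * a * x))
      rw [abs_le]
      constructor <;> nlinarith)
  rw [setIntegral_congr_fun measurableSet_Ioi hcraig, integral_const_mul,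
    setIntegral_congr_fun measurableSet_Ioo hinner] at hswap
  rw [← hswap]
  have := Real.pi_pos
  field_simp

/-! ### Binomial series and termwise integration. -/

lemma ascPochhammer_eval_div_factorial (a : ℝ) (n : ℕ) :
    (ascPochhammer ℝ n).eval a / n.factorial = Ring.choose (a + n - 1) n := by
  rw [← Ring.multichoose_eq, div_eq_iff (by positivity), mul_comm, ← nsmul_eq_mul,
    Ring.factorial_nsmul_multichoose_eq_ascPochhammer, Polynomial.ascPochhammer_smeval_eq_eval]

lemma hasSum_binomial (m : ℝ) {s : ℝ} (h0 : 0 ≤ s) (h1 : s < 1) :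
    HasSum (fun n : ℕ => (ascPochhammer ℝ n).eval (1 - m) / n.factorial * s ^ n)
      ((1 - s) ^ (m - 1)) := by
  have h := (Real.one_div_one_sub_rpow_hasFPowerSeriesOnBall_zero (1 - m)).hasSum (y := s)
    (by simp [Metric.mem_eball, edist_dist, abs_of_nonneg h0, h1])
  rw [zero_add, one_div, ← Real.rpow_neg (by linarith), neg_sub] at h
  refine h.congr_fun ?_
  intro n
  simp [ascPochhammer_eval_div_factorial, mul_comm]

lemma summable_abs_binomial (m : ℝ) {r : ℝ} (h0 : 0 ≤ r) (h1 : r < 1) :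
    Summable fun n : ℕ => |(ascPochhammer ℝ n).eval (1 - m) / n.factorial| * r ^ n := by
  have := (hasSum_binomial m h0 h1).summable.abs
  refine this.congr fun n => ?_
  rw [abs_mul, abs_of_nonneg (pow_nonneg h0 n)]

/-- The binomial expansion of the incomplete beta function. -/
lemma hasSum_incBeta (m : ℝ) {w : ℝ} (h0 : 0 < w) (h1 : w < 1) :
    HasSum (fun n : ℕ => (ascPochhammer ℝ n).eval (1 - m) / n.factorial * w ^ n / (n + 1 / 2))
      (w ^ (-(1 / 2) : ℝ) * incBeta w (1 / 2) m) := by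
  set k : ℕ → ℝ := fun n => (ascPochhammer ℝ n).eval (1 - m) / n.factorial with hk
  have hpow : ∀ n : ℕ, ∫ s in Ioo 0 w, s ^ ((n : ℝ) - 1 / 2) = w ^ (1 / 2 : ℝ) * w ^ n / (n + 1 / 2) := by
    intro n
    have hn : (0 : ℝ) ≤ n := n.cast_nonneg
    rw [← integral_Ioc_eq_integral_Ioo, ← intervalIntegral.integral_of_le h0.le,
      integral_rpow (Or.inl (by linarith)), Real.zero_rpow (by linarith),
      show (n : ℝ) - 1 / 2 + 1 = 1 / 2 + n by ring, Real.rpow_add h0, Real.rpow_natCast]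
    ring
  have hint : ∀ n : ℕ, IntegrableOn (fun s : ℝ => s ^ ((n : ℝ) - 1 / 2)) (Ioo 0 w) := by
    intro n
    have hn : (0 : ℝ) ≤ n := n.cast_nonneg
    rw [intervalIntegral.integrableOn_Ioo_rpow_iff h0]
    linarith
  have h := hasSum_integral_of_summable_integral_norm (μ := volume.restrict (Ioo 0 w))
    (F := fun (n : ℕ) (s : ℝ) => k n * s ^ ((n : ℝ) - 1 / 2)) (fun n => (hint n).const_mul _) (by
      have e : ∀ n : ℕ, ∫ s in Ioo 0 w, ‖k n * s ^ ((n : ℝ) - 1 / 2)‖ =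
          |k n| * (w ^ (1 / 2 : ℝ) * w ^ n / (n + 1 / 2)) := by
        intro n
        rw [← hpow, ← integral_const_mul]
        refine setIntegral_congr_fun measurableSet_Ioo fun s hs => ?_
        have := hs.1
        simp only [norm_mul, Real.norm_eq_abs]
        rw [abs_of_nonneg (a := s ^ _) (by positivity)]
      simp only [e]
      -- The constant `2` bounds `1 / (n + 1/2)`.
      refine Summable.of_nonneg_of_le (fun n => by positivity) (fun n => ?_)
        ((summable_abs_binomial m h0.le h1).mul_right (2 * w ^ (1 / 2 : ℝ)))
      have hn : (0 : ℝ) ≤ n := n.cast_nonneg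
      rw [mul_assoc]
      refine mul_le_mul_of_nonneg_left ?_ (abs_nonneg _)
      rw [div_le_iff₀ (by positivity)]
      have : 0 ≤ w ^ (1 / 2 : ℝ) * w ^ n * n := by positivity
      nlinarith)
  have hsum : ∫ s in Ioo 0 w, ∑' n : ℕ, k n * s ^ ((n : ℝ) - 1 / 2) = incBeta w (1 / 2) m := by
    rw [incBeta_eq_setIntegral h0.le]
    refine setIntegral_congr_fun measurableSet_Ioo fun s hs => ?_
    have := ((hasSum_binomial m hs.1.le (hs.2.trans h1)).mul_left (s ^ (1 / 2 - 1 : ℝ))).tsum_eq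
    rw [← this]
    refine tsum_congr fun n => ?_
    rw [show (n : ℝ) - 1 / 2 = 1 / 2 - 1 + n by ring, Real.rpow_add hs.1, Real.rpow_natCast]
    ring
  rw [hsum] at h
  refine (h.mul_left _).congr_fun fun n => ?_
  have : w ^ (-(1 / 2) : ℝ) * w ^ (1 / 2 : ℝ) = 1 := by
    rw [← Real.rpow_add h0]; norm_num
  rw [integral_const_mul, hpow]
  linear_combination (-(k n * w ^ n / (n + 1 / 2))) * this

/-- The integrand whose integral over `(0, 1)` is the `n`-th term of the series. -/
def seriesIntegrand (b m : ℝ) (n : ℕ) (t : ℝ) : ℝ :=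
  t ^ m * (1 - t) ^ (-(1 / 2) : ℝ) * (1 + b * t) ^ (-m) * (1 + (1 + b) * t) ^ (-(1 / 2) : ℝ) /
    beta (1 / 2) m * ((ascPochhammer ℝ n).eval (1 - m) / n.factorial *
      (t / (1 + (1 + b) * t)) ^ n / (n + 1 / 2))

/-- The `n`-th power of `t / (1 + (1 + b)t)` is absorbed into the Euler kernel by shifting two
exponents, and `B(n + m + 1, 1/2)` cancels the normalization of `F₁`. -/
lemma R2term_eq_integral {α g m : ℝ} (hα : 0 < α) (hg : 0 < g) (hm : 0 < m) (n : ℕ) :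
    R2term α g m n = ∫ t in Ioo (0 : ℝ) 1, seriesIntegrand (m / (α * g)) m n t := by
  have hb : 0 < m / (α * g) := by positivity
  set b := m / (α * g) with hb'
  have hn : (0 : ℝ) ≤ n := n.cast_nonneg
  have hB := (beta_pos (show (0 : ℝ) < 1 / 2 by norm_num) hm).ne'
  have hB' := (beta_pos (show (0 : ℝ) < n + m + 1 by positivity)
    (show (0 : ℝ) < 1 / 2 by norm_num)).ne'
  rw [R2term, appellF1, ← hb', show m + n + 3 / 2 - (n + m + 1) = (1 / 2 : ℝ) by ring,
    intervalIntegral.integral_of_le zero_le_one, integral_Ioc_eq_integral_Ioo]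
  have e : ∀ t ∈ Ioo (0 : ℝ) 1, seriesIntegrand b m n t =
      (ascPochhammer ℝ n).eval (1 - m) / (n.factorial * (n + 1 / 2) * beta (1 / 2) m) *
      (t ^ ((n : ℝ) + m + 1 - 1) * (1 - t) ^ (1 / 2 - 1 : ℝ) * (1 - -b * t) ^ (-m) *
        (1 - -(1 + b) * t) ^ (-((n : ℝ) + 1 / 2))) := by
    intro t ht
    have h0 := ht.1
    have h1 : 0 < 1 + (1 + b) * t := by positivity
    rw [seriesIntegrand, add_sub_cancel_right, Real.rpow_add h0, Real.rpow_natCast, neg_mul,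
      sub_neg_eq_add, neg_mul, sub_neg_eq_add, neg_add, Real.rpow_add h1,
      Real.rpow_neg h1.le (n : ℝ), Real.rpow_natCast, div_pow,
      show (1 / 2 - 1 : ℝ) = -(1 / 2) by norm_num]
    field_simp
  rw [setIntegral_congr_fun measurableSet_Ioo e, integral_const_mul]
  generalize ∫ t in Ioo (0 : ℝ) 1, t ^ ((n : ℝ) + m + 1 - 1) * (1 - t) ^ (1 / 2 - 1 : ℝ) *
    (1 - -b * t) ^ (-m) * (1 - -(1 + b) * t) ^ (-((n : ℝ) + 1 / 2)) = J
  field_simp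

/-- The sum and the integral are exchanged by comparing norms with the binomial series at `1/2`,
times the integrable weight `(1 - t)^(-1/2)`. -/
lemma hasSum_R2term {α g m : ℝ} (hα : 0 < α) (hg : 0 < g) (hm : 0 < m) :
    HasSum (R2term α g m) (∫ t in Ioo (0 : ℝ) 1,
      t ^ (m - 1 / 2) * (1 - t) ^ (-(1 / 2) : ℝ) * (1 + m / (α * g) * t) ^ (-m) *
        (incBeta (t / (1 + (1 + m / (α * g)) * t)) (1 / 2) m / beta (1 / 2) m)) := by
  have hb : 0 < m / (α * g) := by positivity
  rw [funext (R2term_eq_integral hα hg hm)]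
  set b := m / (α * g)
  have hB := beta_pos (show (0 : ℝ) < 1 / 2 by norm_num) hm
  set k : ℕ → ℝ := fun n => (ascPochhammer ℝ n).eval (1 - m) / n.factorial with hk
  have hdom : IntegrableOn (fun t : ℝ => (1 - t) ^ (-(1 / 2) : ℝ)) (Ioo 0 1) := by
    have := integrableOn_Ioo_beta (p := 1) (q := 1 / 2) one_pos (by norm_num)
    norm_num at this ⊢
    exact this
  have hbound : ∀ n, ∀ t ∈ Ioo (0 : ℝ) 1, ‖seriesIntegrand b m n t‖ ≤
      |k n| * (1 / 2) ^ n * (2 / beta (1 / 2) m) * (1 - t) ^ (-(1 / 2) : ℝ) := by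
    intro n t ht
    obtain ⟨h0, h1⟩ := ht
    have h1' := sub_pos.2 h1
    have hn : (0 : ℝ) ≤ n := n.cast_nonneg
    have hbt : 0 < b * t := by positivity
    -- Equivalent to `t ≤ 1 + b t`; this uniform bound provides the geometric ratio.
    have hw : t / (1 + (1 + b) * t) ≤ 1 / 2 := by
      rw [div_le_div_iff₀ (by positivity) (by norm_num)]
      nlinarith
    have e1 : t ^ m ≤ 1 := Real.rpow_le_one h0.le h1.le hm.le
    have e2 : (1 + b * t) ^ (-m) ≤ 1 :=
      Real.rpow_le_one_of_one_le_of_nonpos (by linarith) (by linarith)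
    have e3 : (1 + (1 + b) * t) ^ (-(1 / 2) : ℝ) ≤ 1 :=
      Real.rpow_le_one_of_one_le_of_nonpos (by nlinarith) (by norm_num)
    have e4 : (t / (1 + (1 + b) * t)) ^ n ≤ (1 / 2) ^ n := pow_le_pow_left₀ (by positivity) hw n
    have e5 : ((n : ℝ) + 1 / 2)⁻¹ ≤ 2 := by
      rw [inv_le_comm₀ (by positivity) (by norm_num)]; linarith
    have hrw : ‖seriesIntegrand b m n t‖ = t ^ m * (1 + b * t) ^ (-m) *
        (1 + (1 + b) * t) ^ (-(1 / 2) : ℝ) * (t / (1 + (1 + b) * t)) ^ n *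
        ((n : ℝ) + 1 / 2)⁻¹ * (|k n| / beta (1 / 2) m * (1 - t) ^ (-(1 / 2) : ℝ)) := by
      rw [seriesIntegrand, norm_mul, Real.norm_of_nonneg (by positivity), norm_div, norm_mul,
        Real.norm_of_nonneg (r := (t / (1 + (1 + b) * t)) ^ n) (by positivity),
        Real.norm_of_nonneg (r := (n : ℝ) + 1 / 2) (by positivity), Real.norm_eq_abs]
      ring
    rw [hrw]
    calc _ ≤ 1 * 1 * 1 * (1 / 2) ^ n * 2 *
          (|k n| / beta (1 / 2) m * (1 - t) ^ (-(1 / 2) : ℝ)) := by gcongr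
      _ = _ := by ring
  have hmeas : ∀ n, Measurable (seriesIntegrand b m n) := by
    intro n
    unfold seriesIntegrand
    fun_prop
  have hint : ∀ n, IntegrableOn (seriesIntegrand b m n) (Ioo 0 1) := fun n =>
    (hdom.const_mul _).mono' (hmeas n).aestronglyMeasurable
      (ae_restrict_of_forall_mem measurableSet_Ioo (hbound n))
  have h := hasSum_integral_of_summable_integral_norm (μ := volume.restrict (Ioo 0 1))
    (F := seriesIntegrand b m) hint (by
      refine Summable.of_nonneg_of_le (fun n => by positivity)
        (fun n => ?_) (((summable_abs_binomial m (r := 1 / 2) (by norm_num) (by norm_num)).mul_right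
          (2 / beta (1 / 2) m)).mul_right (∫ t in Ioo (0 : ℝ) 1, (1 - t) ^ (-(1 / 2) : ℝ)))
      rw [← integral_const_mul]
      exact setIntegral_mono_on (hint n).norm (hdom.const_mul _) measurableSet_Ioo (hbound n))
  suffices hpt : EqOn (fun t : ℝ => ∑' n : ℕ, seriesIntegrand b m n t) (fun t =>
      t ^ (m - 1 / 2) * (1 - t) ^ (-(1 / 2) : ℝ) * (1 + b * t) ^ (-m) *
        (incBeta (t / (1 + (1 + b) * t)) (1 / 2) m / beta (1 / 2) m)) (Ioo 0 1) by
    rw [setIntegral_congr_fun measurableSet_Ioo hpt] at h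
    exact h
  intro t ht
  obtain ⟨h0, h1⟩ := ht
  have hd : 0 < 1 + (1 + b) * t := by positivity
  have hw1 : t / (1 + (1 + b) * t) < 1 := by
    rw [div_lt_one hd]
    have : 0 < b * t := by positivity
    linarith
  have hs := ((hasSum_incBeta m (div_pos h0 hd) hw1).mul_left
    (t ^ m * (1 - t) ^ (-(1 / 2) : ℝ) * (1 + b * t) ^ (-m) * (1 + (1 + b) * t) ^ (-(1 / 2) : ℝ) /
      beta (1 / 2) m)).tsum_eq
  simp only [seriesIntegrand]
  -- The factor `w^(-1/2)` from `hasSum_incBeta` lowers `t^m` to `t^(m - 1/2)` and cancels `(1 + (1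
  -- + b)t)^(-1/2)`.
  rw [hs, Real.div_rpow h0.le hd.le, sub_eq_add_neg m, Real.rpow_add h0]
  have : (1 + (1 + b) * t) ^ (-(1 / 2) : ℝ) ≠ 0 := by positivity
  field_simp

/-! ### Identification of `R₂` and conclusion. -/

lemma beta_comm (p q : ℝ) : beta p q = beta q p := by
  rw [beta, beta, mul_comm, add_comm]

/-- Both sides are integrals over `t ∈ (0, 1)`; with rate `c = m/g = α b` the integrands agree
pointwise. -/
lemma R2_eq_integral {α g m : ℝ} (hα : 0 < α) (hg : 0 < g) (hm : 0 < m) :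
    R2 α g m = ∫ x in Ioi (0 : ℝ), gaussQ (Real.sqrt (2 * α * x)) *
        (1 / 2 - gaussQ (Real.sqrt (2 * α * x))) * snrPDF m g x := by
  have hc : 0 < m / g := by positivity
  have hb : 0 < m / (α * g) := by positivity
  have hB := beta_pos (show (0 : ℝ) < 1 / 2 by norm_num) hm
  have := Real.pi_pos
  simp only [snrPDF]
  rw [integral_gaussQ_mul_half_sub_mul_gammaPDFReal hα hm hc, R2, (hasSum_R2term hα hg hm).tsum_eq,
    ← integral_const_mul, ← integral_const_mul]
  refine setIntegral_congr_fun measurableSet_Ioo fun t ht => ?_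
  obtain ⟨h0, h1⟩ := ht
  have e1 : α / (m / g + α / t + α) = t / (1 + (1 + m / (α * g)) * t) := by
    field_simp
    ring
  have e2 : (m / g) ^ m * (m / g + α / t) ^ (-m) =
      (m / (α * g)) ^ m * t ^ m * (1 + m / (α * g) * t) ^ (-m) := by
    rw [Real.rpow_neg (by positivity), Real.rpow_neg (by positivity), ← Real.inv_rpow (by positivity),
      ← Real.inv_rpow (by positivity), ← Real.mul_rpow (by positivity) (by positivity),
      ← Real.mul_rpow (by positivity) (by positivity),
      ← Real.mul_rpow (by positivity) (by positivity)]
    congr 1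
    field_simp
    ring
  rw [e1, e2, sub_eq_add_neg m, Real.rpow_add h0]
  field_simp
  ring

end Nakagami

end

open Nakagami in
theorem lemma3 (α g m : ℝ) (hα : 0 < α) (hg : 0 < g) (hm : 0 < m) :
    IntegrableOn
      (fun x : ℝ => Nakagami.gaussQ (Real.sqrt (2 * α * x)) ^ 2 * Nakagami.snrPDF m g x)
      (Ioi 0) ∧
    Summable (Nakagami.R2term α g m) ∧
    ∫ x in Ioi (0 : ℝ),
        Nakagami.gaussQ (Real.sqrt (2 * α * x)) ^ 2 * Nakagami.snrPDF m g x =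
      Nakagami.regIncBeta (m / (m + α * g)) m (1 / 2) / 4 - Nakagami.R2 α g m := by
  have hc : 0 < m / g := by positivity
  have hQ : Measurable fun x : ℝ => gaussQ (Real.sqrt (2 * α * x)) :=
    measurable_gaussQ.comp (by fun_prop)
  have hb : ∀ x, 0 < x → 0 ≤ gaussQ (Real.sqrt (2 * α * x)) ∧ gaussQ (Real.sqrt (2 * α * x)) ≤ 1 / 2 :=
    fun x hx => ⟨gaussQ_nonneg _, gaussQ_le_half hα hx⟩
  have hi2 : IntegrableOn (fun x : ℝ => gaussQ (Real.sqrt (2 * α * x)) ^ 2 * snrPDF m g x)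
      (Ioi 0) := by
    refine integrableOn_mul_gammaPDFReal (C := 1) hm hc (hQ.pow_const 2) fun x hx => ?_
    obtain ⟨h1, h2⟩ := hb x hx
    rw [abs_le]
    constructor <;> nlinarith
  have hi1 : IntegrableOn (fun x : ℝ => (1 / 2 - gaussQ (Real.sqrt (2 * α * x))) * snrPDF m g x)
      (Ioi 0) := by
    refine integrableOn_mul_gammaPDFReal (C := 1) hm hc (measurable_const.sub hQ) fun x hx => ?_
    obtain ⟨h1, h2⟩ := hb x hx
    rw [abs_le]
    constructor <;> linarith
  have hi0 : IntegrableOn (snrPDF m g) (Ioi 0) := integrableOn_gammaPDFReal hm hc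
  refine ⟨hi2, (hasSum_R2term hα hg hm).summable, ?_⟩
  -- Integrated form of `Q(1/2 - Q) = 1/4 - (1/2)(1/2 - Q) - Q²`.
  have hR : R2 α g m = 1 / 4 * (∫ x in Ioi 0, snrPDF m g x) -
      1 / 2 * (∫ x in Ioi (0 : ℝ), (1 / 2 - gaussQ (Real.sqrt (2 * α * x))) * snrPDF m g x) -
      ∫ x in Ioi (0 : ℝ), gaussQ (Real.sqrt (2 * α * x)) ^ 2 * snrPDF m g x := by
    rw [R2_eq_integral hα hg hm, ← integral_const_mul, ← integral_const_mul,
      ← integral_sub (hi0.const_mul _) (hi1.const_mul _),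
      ← integral_sub (by exact (hi0.const_mul _).sub (hi1.const_mul _)) hi2]
    refine integral_congr_ae (ae_of_all _ fun x => ?_)
    ring
  have h0 : ∫ x in Ioi 0, snrPDF m g x = 1 := integral_Ioi_gammaPDFReal hm hc
  have h1 : ∫ x in Ioi (0 : ℝ), (1 / 2 - gaussQ (Real.sqrt (2 * α * x))) * snrPDF m g x = _ :=
    integral_half_sub_gaussQ_mul_gammaPDFReal hα hm hc
  have hB := ProbabilityTheory.beta_pos (show (0 : ℝ) < 1 / 2 by norm_num) hm
  have hs := incBeta_add_symm (x := α / (m / g + α)) (p := 1 / 2) (q := m) (by positivity)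
    (div_le_one_of_le₀ (by linarith) (by positivity)) (by norm_num) hm
  rw [show 1 - α / (m / g + α) = m / (m + α * g) by field_simp; ring] at hs
  rw [h0, h1] at hR
  rw [hR, regIncBeta, beta_comm m, eq_sub_iff_add_eq.2 hs]
  field_simp
  ring
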